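/- Let $\mathcal X$ and $\widehat{\mathcal X}$ be finite alphabets, $d:\mathcal X\times\widehat{\mathcal X}\to[0,\infty)$ a distortion measure, $d_n(x^n,\hat x^n)=\frac1n\sum_{k=1}^n d(x_k,\hat x_k)$, and $d_n(x^n;\mathcal B)=\min_{\hat x^n\in\mathcal B}d_n(x^n,\hat x^n)$ for a nonempty codebook $\mathcal B\subseteq\widehat{\mathcal X}^n$. Let $m\ge 1$ subsources be given whose output vectors $(x_{1,k},\dots,x_{m,k})\in\mathcal X^m$, $k=1,2,\dots$, are IID with a joint distribution $P$ (the $m$ components may be dependent). A switcher with full lookahead picks the switch positions $s^n\in\{1,\dots,m\}^n$ according to a conditional distribution $P(s^n\mid x_1^n,\dots,x_m^n)$ given all the subsource outputs of the block, and the source output is $x_k=x_{s_k,k}$. The switcher is helpful and knows the codebook: let $M(n,D)$ be the minimal size of a codebook $\mathcal B\subseteq\widehat{\mathcal X}^n$ for which there exists such a strategy with $\mathbb E[d_n(x^n;\mathcal B)]\le D$ ($M(n,D)=\infty$ if there is none), and let $R(D)=\limsup_{n\to\infty}\frac1n\ln M(n,D)$. Let $\mathcal X^\ast=\{\mathcal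 V\subseteq\mathcal X:\mathcal V\ne\emptyset,\ |\mathcal V|\le m\}$, $\rho(\mathcal V,\hat x)=\min_{x\in\mathcal V}d(x,\hat x)$, $\mathcal V_k=\{x_{1,k},\dots,x_{m,k}\}$, and $\beta(\mathcal V)=P(\{x_{1,1},\dots,x_{m,1}\}=\mathcal V)$. Let $R^\ast(\beta,D)=\min_W I(\beta,W)$ be the IID rate-distortion function of $\beta$ with respect to $\rho$: the minimum of the mutual information (in nats) over the transition matrices $W$ from $\mathcal X^\ast$ to $\widehat{\mathcal X}$ with $\sum_{\mathcal V,\hat x}\beta(\mathcal V)W(\hat x|\mathcal V)\rho(\mathcal V,\hat x)\le D$, or $\infty$ if there are none. Let $D_{\min}=\sum_{\mathcal V}\beta(\mathcal V)\min_{\hat x}\rho(\mathcal V,\hat x)$. Then $\beta$ is a probability distribution on $\mathcal X^\ast$, the sets $\mathcal V_1,\mathcal V_2,\dots$ are IID with distribution $\beta$, and for every real $D\ne D_{\min}$ $$R(D)=\lim_{n\to\infty}\tfrac1n\ln M(n,D)=R^\ast(\beta,D)$$ (both sides are $\infty$ for $D<D_{\min}$). At $D=D_{\min}$ the same equality holds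 with $R(D_{\min})$ read as $\lim_{D\downarrow D_{\min}}R(D)$, i.e. $\lim_{D\downarrow D_{\min}}R(D)=R^\ast(\beta,D_{\min})$. Moreover, for $D>D_{\min}$, $R^\ast(\beta,D)$ is the smallest rate $R$ for which there are codebooks $\mathcal B_n\subseteq\widehat{\mathcal X}^n$ and switcher strategies, one for each $n\ge1$, with expected distortion at most $D$ and $\frac1n\ln|\mathcal B_n|\to R$. -/

import Mathlib

open Filter Topology

noncomputable section

namespace SwitcherAVS

/-! ### The rate-distortion function of an IID source with finite alphabets -/

section IID

variable {A Y : Type*} [Fintype A] [Fintype Y]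

/-- The mutual information `I(p, W)` in nats of a source distribution `p` on `A` and a
transition matrix `W` from `A` to `Y`. Terms with `p a * W a y = 0` contribute `0`. -/
def mutualInfo (p : A → ℝ) (W : A → Y → ℝ) : ℝ :=
  ∑ a, ∑ y, p a * W a y * Real.log (W a y / ∑ a', p a' * W a' y)

/-- The set `𝒲(p, D)` of probability transition matrices from `A` to `Y` whose average
distortion under the source distribution `p` is at most `D`. -/
def feasibleChannels (p : A → ℝ) (ρ : A → Y → ℝ) (D : ℝ) : Set (A → Y → ℝ) :=
  {W | (∀ a, W a ∈ stdSimplex ℝ Y) ∧ ∑ a, ∑ y, p a * W a y * ρ a y ≤ D}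

/-- The IID rate-distortion function: the minimum of `I(p, W)` over `W ∈ 𝒲(p, D)`,
with value `⊤` if there is no such `W`. -/
def iidRateDistortion (p : A → ℝ) (ρ : A → Y → ℝ) (D : ℝ) : EReal :=
  ⨅ W ∈ feasibleChannels p ρ D, (mutualInfo p W : EReal)

/-- The minimum average distortion `∑ a, p a * min_y ρ a y`. -/
def minDistortion [Nonempty Y] (p : A → ℝ) (ρ : A → Y → ℝ) : ℝ :=
  ∑ a, p a * Finset.univ.inf' Finset.univ_nonempty (ρ a)

end IID

/-! ### Block distortion -/

section Block

variable {X Y : Type*}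

/-- The per-letter distortion `d_n(x, y) = (1/n) ∑ k, d (x k) (y k)`. -/
def blockDistortion (d : X → Y → ℝ) {n : ℕ} (x : Fin n → X) (y : Fin n → Y) : ℝ :=
  (1 / (n : ℝ)) * ∑ k, d (x k) (y k)

/-- The distortion `d_n(x; B) = min_{y ∈ B} d_n(x, y)` for a nonempty codebook `B`. -/
def codebookDistortion (d : X → Y → ℝ) {n : ℕ} (B : Finset (Fin n → Y)) (hB : B.Nonempty)
    (x : Fin n → X) : ℝ :=
  B.inf' hB (blockDistortion d x)

end Block

/-! ### The arbitrarily varying source with a helpful switcher with full lookahead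

There are `m` subsources with alphabet `X`; the vector of the `m` outputs at one time has joint
distribution `P` on `Fin m → X` and the vectors at different times are IID. A realization of all
subsources over a block of length `n` is `z : Fin n → Fin m → X`, so `z k l` is the output of
subsource `l` at time `k`. -/

section Switcher

variable {X Y : Type*} [Fintype X] {m : ℕ}

/-- The probability of a realization of the subsources over a block of length `n`. -/
def blockProb (P : (Fin m → X) → ℝ) {n : ℕ} (z : Fin n → Fin m → X) : ℝ :=
  ∏ k, P (z k)

/-- The output of the source when the switch positions are `s`. -/
def switchOutput {n : ℕ} (z : Fin n → Fin m → X) (s : Fin n → Fin m) : Fin n → X :=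
  fun k => z k (s k)

/-- A (possibly random) full-lookahead strategy: for each realization `z` of all subsources over
the whole block, a probability mass function `S z` on the vectors of switch positions. -/
def IsFullLookaheadStrategy {n : ℕ} (S : (Fin n → Fin m → X) → (Fin n → Fin m) → ℝ) : Prop :=
  ∀ z, S z ∈ stdSimplex ℝ (Fin n → Fin m)

/-- The expected distortion `E[d_n(x; B)]` of the output under the strategy `S`. -/
def expectedDistortion (P : (Fin m → X) → ℝ) (d : X → Y → ℝ) {n : ℕ}
    (S : (Fin n → Fin m → X) → (Fin n → Fin m) → ℝ)
    (B : Finset (Fin n → Y)) (hB : B.Nonempty) : ℝ :=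
  ∑ z, ∑ s, blockProb P z * S z s * codebookDistortion d B hB (switchOutput z s)

/-- The codebook `B` is good at distortion `D`: some full-lookahead strategy, which may be chosen
with knowledge of `B`, makes the expected distortion at most `D`. -/
def HelpfulFeasible (P : (Fin m → X) → ℝ) (d : X → Y → ℝ) (D : ℝ) {n : ℕ}
    (B : Finset (Fin n → Y)) : Prop :=
  ∃ hB : B.Nonempty, ∃ S : (Fin n → Fin m → X) → (Fin n → Fin m) → ℝ,
    IsFullLookaheadStrategy S ∧ expectedDistortion P d S B hB ≤ D

/-- The minimal size `M(n, D)` of a codebook of block length `n` that is good at distortion `D`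
(`⊤` if there is none). -/
def helpfulCodebookSize (P : (Fin m → X) → ℝ) (d : X → Y → ℝ) (D : ℝ) (n : ℕ) : ℕ∞ :=
  ⨅ B ∈ {B : Finset (Fin n → Y) | HelpfulFeasible P d D B}, (B.card : ℕ∞)

/-- `(1/n) ln M(n, D)`. -/
def helpfulRate (P : (Fin m → X) → ℝ) (d : X → Y → ℝ) (D : ℝ) (n : ℕ) : EReal :=
  ENNReal.log (helpfulCodebookSize P d D n : ENNReal) / (n : EReal)

/-- The rate-distortion function `R(D) = limsup (1/n) ln M(n, D)` of the source with a helpful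
full-lookahead switcher. -/
def helpfulRateDistortion (P : (Fin m → X) → ℝ) (d : X → Y → ℝ) (D : ℝ) : EReal :=
  limsup (helpfulRate P d D) atTop

/-- The rate `R` is achievable at distortion `D`: for each block length there are a codebook and a
switcher strategy with expected distortion at most `D`, the rates of the codebooks tending
to `R`. -/
def HelpfulAchievable (P : (Fin m → X) → ℝ) (d : X → Y → ℝ) (D : ℝ) (R : ℝ) : Prop :=
  ∃ B : (n : ℕ) → Finset (Fin n → Y), (∀ n, 1 ≤ n → HelpfulFeasible P d D (B n)) ∧
    Tendsto (fun n : ℕ => Real.log ((B n).card : ℝ) / (n : ℝ)) atTop (𝓝 R)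

end Switcher

/-! ### The candidate-set source -/

section Candidate

variable {X Y : Type*}

/-- The alphabet of nonempty subsets of `X` with at most `m` elements. -/
abbrev CandidateSet (X : Type*) (m : ℕ) : Type _ :=
  {V : Finset X // V.Nonempty ∧ V.card ≤ m}

/-- The distortion `ρ(V, y) = min_{x ∈ V} d x y`. -/
def candidateDistortion (m : ℕ) (d : X → Y → ℝ) (V : CandidateSet X m) (y : Y) : ℝ :=
  V.1.inf' V.2.1 (fun x => d x y)

/-- The distribution `β(V) = P({x_1, …, x_m} = V)` of the candidate set. -/
def candidateDist [Fintype X] [DecidableEq X] {m : ℕ} (P : (Fin m → X) → ℝ)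
    (V : CandidateSet X m) : ℝ :=
  ∑ x : Fin m → X with Finset.univ.image x = V.1, P x

end Candidate

end SwitcherAVS

end

open SwitcherAVS

/-! A helpful switcher who knows the codebook can pick a codeword `y` and then, at each time, a
subsource whose letter is closest to `y k`. No switch sequence does better and randomization cannot
help, so at every block length the problem is exactly fixed-length coding of the IID source of
candidate sets with law `β` and distortion `ρ` (`helpfulFeasible_iff`). What remains is Shannon's
source coding theorem with expected distortion.

The converse (`exists_channel_of_codebook`) holds at each block length `n ≥ 1`: averaging the joint
law of source letter and codeword letter over time gives a feasible channel whose information is at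
most the codebook rate. Achievability (`eventually_exists_codebook`) is random coding:
`exists_covering` bounds the uncovered mass, and Chernoff bounds make the atypical mass vanish.

Random coding needs slack in the distortion constraint. For `D > D_min`, mixing in a
distortion-minimizing channel provides it; for `D < D_min` both sides are `⊤`; at `D_min` itself
right continuity of the rate-distortion function, from compactness of the set of channels, takes
over. -/

namespace SwitcherAVS

/-! ### Sums over product distributions and exponential tail bounds. -/

section ProductSums

variable {A : Type*} [Fintype A] {n : ℕ}

theorem sum_prod_eq_prod_sum (F : Fin n → A → ℝ) :
    ∑ v : Fin n → A, ∏ k, F k (v k) = ∏ k, ∑ a, F k a := by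
  classical
  rw [Finset.prod_univ_sum, Fintype.piFinset_univ]

theorem sum_prod_eq_one {p : A → ℝ} (hp : ∑ a, p a = 1) :
    ∑ v : Fin n → A, ∏ k, p (v k) = 1 := by
  rw [sum_prod_eq_prod_sum (fun _ => p)]
  simp [hp]

theorem sum_prod_mul_eval {p : A → ℝ} (hp : ∑ a, p a = 1) (g : A → ℝ) (k : Fin n) :
    ∑ v : Fin n → A, (∏ j, p (v j)) * g (v k) = ∑ a, p a * g a := by
  have h := sum_prod_eq_prod_sum (fun j a => p a * if j = k then g a else 1)
  simp only [Finset.prod_mul_distrib, Finset.prod_ite_eq', Finset.mem_univ, if_true] at h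
  rw [h, Finset.prod_eq_single k]
  · simp
  · intro j _ hj
    simp [hj, hp]
  · simp

/-- Chernoff bound for product distributions, in exponential form. -/
theorem sum_prod_indicator_le {r : A → ℝ} (hr : ∀ a, 0 ≤ r a) (g : A → ℝ) {l : ℝ} (hl : 0 ≤ l) :
    ∑ v : Fin n → A, (∏ k, r (v k)) * (if 0 < ∑ k, g (v k) then 1 else 0) ≤
      (∑ a, r a * Real.exp (l * g a)) ^ n := by
  have h := sum_prod_eq_prod_sum (n := n) (fun _ a => r a * Real.exp (l * g a))
  simp only [Finset.prod_const, Finset.card_univ, Fintype.card_fin, Finset.prod_mul_distrib,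
    ← Real.exp_sum, ← Finset.mul_sum] at h
  rw [← h]
  refine Finset.sum_le_sum fun v _ => ?_
  refine mul_le_mul_of_nonneg_left ?_ (Finset.prod_nonneg fun k _ => hr _)
  split_ifs with h1
  · exact Real.one_le_exp (mul_nonneg hl h1.le)
  · exact (Real.exp_pos _).le

/-- The moment generating function equals 1 at 0 and its derivative there is the negative mean, so
it drops below 1 just to the right of 0. -/
theorem exists_sum_mul_exp_lt_one {r g : A → ℝ} (hr1 : ∑ a, r a = 1)
    (hg : ∑ a, r a * g a < 0) : ∃ l : ℝ, 0 ≤ l ∧ ∑ a, r a * Real.exp (l * g a) < 1 := by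
  have hder : HasDerivAt (fun l : ℝ => ∑ a, r a * Real.exp (l * g a)) (∑ a, r a * g a) 0 := by
    refine HasDerivAt.fun_sum fun a _ => ?_
    have := (((hasDerivAt_id (0 : ℝ)).mul_const (g a)).exp).const_mul (r a)
    simpa using this
  have hev := hder.hasDerivWithinAt (s := Set.Ioi 0)
  have h2 := (hasDerivWithinAt_iff_tendsto_slope' (by simp)).1 hev
  have h3 : ∀ᶠ l in 𝓝[>] (0 : ℝ), slope (fun l : ℝ => ∑ a, r a * Real.exp (l * g a)) 0 l < 0 :=
    h2.eventually (gt_mem_nhds hg)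
  obtain ⟨l, hl, hl0⟩ := (h3.and self_mem_nhdsWithin).exists
  have hl0' : (0 : ℝ) < l := hl0
  refine ⟨l, hl0'.le, ?_⟩
  rw [slope_def_field, sub_zero, div_neg_iff] at hl
  simp only [zero_mul, Real.exp_zero, mul_one, hr1] at hl
  rcases hl with h | h <;> linarith [h.1, h.2]

theorem tendsto_sum_prod_indicator {r g : A → ℝ} (hr : ∀ a, 0 ≤ r a) (hr1 : ∑ a, r a = 1)
    (hg : ∑ a, r a * g a < 0) :
    Tendsto (fun n : ℕ => ∑ v : Fin n → A,
      (∏ k, r (v k)) * (if 0 < ∑ k, g (v k) then 1 else 0)) atTop (𝓝 (0 : ℝ)) := by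
  obtain ⟨l, hl, hlt⟩ := exists_sum_mul_exp_lt_one hr1 hg
  refine squeeze_zero (fun n => ?_) (fun n => sum_prod_indicator_le hr g hl)
    (tendsto_pow_atTop_nhds_zero_of_lt_one ?_ hlt)
  · exact Finset.sum_nonneg fun v _ => mul_nonneg (Finset.prod_nonneg fun k _ => hr _)
      (by split_ifs <;> norm_num)
  · exact Finset.sum_nonneg fun a _ => mul_nonneg (hr a) (Real.exp_pos _).le

/-- The probabilistic method: some outcome is no worse than the mean. -/
theorem exists_le_of_sum_mul_le {C : Type*} [Fintype C] {w f : C → ℝ} {b : ℝ}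
    (hw : ∀ c, 0 ≤ w c) (hw1 : ∑ c, w c = 1) (h : ∑ c, w c * f c ≤ b) : ∃ c, f c ≤ b := by
  by_contra! hc
  obtain ⟨c, hc0⟩ : ∃ c, w c ≠ 0 := by
    by_contra! h0
    simp [h0] at hw1
  have : ∑ c, w c * b < ∑ c, w c * f c :=
    Finset.sum_lt_sum (fun c _ => mul_le_mul_of_nonneg_left (hc c).le (hw c))
      ⟨c, Finset.mem_univ _, mul_lt_mul_of_pos_left (hc c) (lt_of_le_of_ne (hw c) hc0.symm)⟩
  rw [← Finset.sum_mul, hw1] at this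
  linarith

end ProductSums

/-! ### Random covering. -/

section Covering

/-- Random covering: some codebook with `N` words drawn from `q` covers all but a small part of
the source, provided that the kernel `K` is dominated by `c * q` on the covering relation `T`. -/
theorem exists_covering {V U : Type*} [Fintype V] [Fintype U] {p : V → ℝ} {q : U → ℝ}
    {K : V → U → ℝ} {T : V → U → Prop} [∀ v u, Decidable (T v u)] {c : ℝ}
    (hp : p ∈ stdSimplex ℝ V) (hq : q ∈ stdSimplex ℝ U) (hK : ∀ v, K v ∈ stdSimplex ℝ U) (hc : 0 < c)
    (hT : ∀ v, p v ≠ 0 → ∀ u, T v u → K v u ≤ c * q u) (N : ℕ) :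
    ∃ C : Fin N → U, ∑ v, p v * (if ∀ i, ¬ T v (C i) then 1 else 0) ≤
      ∑ v, ∑ u, p v * K v u * (if T v u then 0 else 1) + Real.exp (-(N / c)) := by
  -- The `N` words are drawn independently from `q`, and the expected uncovered mass is bounded.
  refine exists_le_of_sum_mul_le (w := fun C : Fin N → U => ∏ i, q (C i))
    (fun C => Finset.prod_nonneg fun i _ => hq.1 _) (sum_prod_eq_one hq.2) ?_
  have hmiss : ∀ v, ∑ C : Fin N → U, (∏ i, q (C i)) * (if ∀ i, ¬ T v (C i) then 1 else 0) =
      (∑ u, q u * (if T v u then 0 else 1)) ^ N := by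
    intro v
    have h := sum_prod_eq_prod_sum (n := N) (fun _ u => q u * (if T v u then (0 : ℝ) else 1))
    simp only [Finset.prod_mul_distrib, Finset.prod_const, Finset.card_univ, Fintype.card_fin] at h
    rw [← h]
    refine Finset.sum_congr rfl fun C _ => ?_
    congr 1
    split_ifs with h1
    · rw [Finset.prod_eq_one]
      intro i _
      simp [h1 i]
    · push Not at h1
      obtain ⟨i, hi⟩ := h1
      exact (Finset.prod_eq_zero (Finset.mem_univ i) (by simp [hi])).symm
  have hbound : ∀ v, p v * (∑ u, q u * (if T v u then 0 else 1)) ^ N ≤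
      p v * (∑ u, K v u * (if T v u then 0 else 1) + Real.exp (-(N / c))) := by
    intro v
    by_cases hv : p v = 0
    · simp [hv]
    refine mul_le_mul_of_nonneg_left ?_ (hp.1 v)
    set t := ∑ u, K v u * (if T v u then 0 else 1) with ht
    have ht0 : 0 ≤ t := Finset.sum_nonneg fun u _ => mul_nonneg ((hK v).1 u)
      (by split_ifs <;> norm_num)
    have ht1 : t ≤ 1 := by
      rw [← (hK v).2]
      refine Finset.sum_le_sum fun u _ => mul_le_of_le_one_right ((hK v).1 u) ?_
      split_ifs <;> norm_num
    have hs0 : 0 ≤ ∑ u, q u * (if T v u then 0 else 1) := Finset.sum_nonneg fun u _ =>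
      mul_nonneg (hq.1 u) (by split_ifs <;> norm_num)
    have hsplit : ∀ f : U → ℝ, ∑ u, f u * (if T v u then 0 else 1) +
        ∑ u, f u * (if T v u then 1 else 0) = ∑ u, f u := by
      intro f
      rw [← Finset.sum_add_distrib]
      refine Finset.sum_congr rfl fun u _ => ?_
      split_ifs <;> ring
    -- Domination of `K` by `c * q` on `T` gives the words related to `v` a `q`-mass of at least `(1
    -- - t) / c`.
    have hs : ∑ u, q u * (if T v u then 0 else 1) ≤ 1 - (1 - t) / c := by
      have h1 : (1 - t) / c ≤ ∑ u, q u * (if T v u then 1 else 0) := by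
        have h2 : 1 - t = ∑ u, K v u * (if T v u then 1 else 0) := by
          have := hsplit (K v)
          have := (hK v).2
          linarith
        rw [div_le_iff₀ hc, h2, Finset.sum_mul]
        refine Finset.sum_le_sum fun u _ => ?_
        split_ifs with h
        · linarith [hT v hv u h]
        · simp
      have := hsplit q
      have := hq.2
      linarith
    have hexp : ∑ u, q u * (if T v u then 0 else 1) ≤ Real.exp (-((1 - t) / c)) :=
      hs.trans (by linarith [Real.add_one_le_exp (-((1 - t) / c))])
    calc (∑ u, q u * (if T v u then 0 else 1)) ^ N
        ≤ Real.exp (-((1 - t) / c)) ^ N := pow_le_pow_left₀ hs0 hexp N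
      -- The exponent is a convex combination of `0` and `-N / c`, so convexity of `exp` separates
      -- the kernel's failure mass `t` from the sampling error.
      _ = Real.exp (t • (0 : ℝ) + (1 - t) • (-(N / c))) := by
          rw [← Real.exp_nat_mul]
          congr 1
          simp only [smul_eq_mul]
          ring
      _ ≤ t • Real.exp 0 + (1 - t) • Real.exp (-(N / c)) :=
          convexOn_exp.2 (Set.mem_univ _) (Set.mem_univ _) ht0 (by linarith) (by ring)
      _ ≤ t + Real.exp (-(N / c)) := by
          have := Real.exp_pos (-((N : ℝ) / c))
          simp only [smul_eq_mul, Real.exp_zero]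
          nlinarith
  calc ∑ C : Fin N → U, (∏ i, q (C i)) * ∑ v, p v * (if ∀ i, ¬ T v (C i) then 1 else 0)
      = ∑ v, p v * (∑ u, q u * (if T v u then 0 else 1)) ^ N := by
        simp_rw [← hmiss, Finset.mul_sum]
        rw [Finset.sum_comm]
        exact Finset.sum_congr rfl fun v _ => Finset.sum_congr rfl fun C _ => by ring
    _ ≤ ∑ v, p v * (∑ u, K v u * (if T v u then 0 else 1) + Real.exp (-(N / c))) :=
        Finset.sum_le_sum fun v _ => hbound v
    _ = _ := by
        simp_rw [mul_add, Finset.sum_add_distrib, ← Finset.sum_mul, hp.2, one_mul, Finset.mul_sum,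
          mul_assoc]

end Covering

/-! ### Nonnegativity and continuity of mutual information. -/

section MutualInformation

variable {A Y : Type*} [Fintype A]

theorem output_nonneg {p : A → ℝ} {W : A → Y → ℝ} (hp : ∀ a, 0 ≤ p a) (hW : ∀ a y, 0 ≤ W a y)
    (y : Y) : 0 ≤ ∑ a, p a * W a y :=
  Finset.sum_nonneg fun a _ => mul_nonneg (hp a) (hW a y)

theorem output_pos {p : A → ℝ} {W : A → Y → ℝ} (hp : ∀ a, 0 ≤ p a) (hW : ∀ a y, 0 ≤ W a y)
    {a : A} {y : Y} (h : 0 < p a * W a y) : 0 < ∑ a', p a' * W a' y :=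
  h.trans_le (Finset.single_le_sum (f := fun a' => p a' * W a' y)
    (fun a' _ => mul_nonneg (hp a') (hW a' y)) (Finset.mem_univ a))

variable [Fintype Y]

theorem output_mem_stdSimplex {p : A → ℝ} {W : A → Y → ℝ} (hp : p ∈ stdSimplex ℝ A)
    (hW : ∀ a, W a ∈ stdSimplex ℝ Y) : (fun y => ∑ a, p a * W a y) ∈ stdSimplex ℝ Y := by
  refine ⟨output_nonneg hp.1 fun a => (hW a).1, ?_⟩
  rw [Finset.sum_comm]
  simp_rw [← Finset.mul_sum, (hW _).2, mul_one, hp.2]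

/-- Termwise `1 - 1/x ≤ log x` gives lower bounds `p a * (W a y - q y)`, which sum to zero. -/
theorem mutualInfo_nonneg {p : A → ℝ} {W : A → Y → ℝ} (hp : p ∈ stdSimplex ℝ A)
    (hW : ∀ a, W a ∈ stdSimplex ℝ Y) : 0 ≤ mutualInfo p W := by
  have hq := output_mem_stdSimplex hp hW
  set q := fun y => ∑ a, p a * W a y with hqdef
  have h0 : ∑ a, ∑ y, p a * (W a y - q y) = 0 := by
    simp_rw [← Finset.mul_sum, Finset.sum_sub_distrib, (hW _).2, hq.2]
    simp
  rw [← h0]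
  refine Finset.sum_le_sum fun a _ => Finset.sum_le_sum fun y _ => ?_
  have hWy := (hW a).1 y
  rcases (mul_nonneg (hp.1 a) hWy).eq_or_lt with h | h
  · rw [← h, zero_mul, mul_sub, ← h]
    have := mul_nonneg (hp.1 a) (hq.1 y)
    linarith
  · have hqy : 0 < q y := output_pos hp.1 (fun a => (hW a).1) h
    have hWpos : 0 < W a y := lt_of_le_of_ne hWy (by rintro h0; simp [← h0] at h)
    have hl := Real.one_sub_inv_le_log_of_pos (div_pos hWpos hqy)
    calc p a * (W a y - q y) = p a * W a y * (1 - (W a y / q y)⁻¹) := by field_simp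
      _ ≤ _ := mul_le_mul_of_nonneg_left hl h.le

/-- Output entropy minus conditional entropy. This form has no quotient, and `Real.negMulLog` is
continuous also at 0, so continuity in `W` follows. -/
theorem mutualInfo_eq {p : A → ℝ} {W : A → Y → ℝ} (hp : ∀ a, 0 ≤ p a) (hW : ∀ a y, 0 ≤ W a y) :
    mutualInfo p W = ∑ y, Real.negMulLog (∑ a, p a * W a y) -
      ∑ a, ∑ y, p a * Real.negMulLog (W a y) := by
  have h : ∀ a y, p a * W a y * Real.log (W a y / ∑ a', p a' * W a' y) =
      -(p a * W a y * Real.log (∑ a', p a' * W a' y)) - p a * Real.negMulLog (W a y) := by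
    intro a y
    rcases (mul_nonneg (hp a) (hW a y)).eq_or_lt with h | h
    · simp only [Real.negMulLog, neg_mul, mul_neg, ← mul_assoc, ← h]
      simp
    · have hq := output_pos hp hW h
      have hWpos : 0 < W a y := lt_of_le_of_ne (hW a y) (by rintro h0; simp [← h0] at h)
      rw [Real.log_div hWpos.ne' hq.ne', Real.negMulLog]
      ring
  simp_rw [mutualInfo, h, Finset.sum_sub_distrib]
  congr 1
  rw [Finset.sum_comm]
  refine Finset.sum_congr rfl fun y _ => ?_
  rw [Finset.sum_neg_distrib, ← Finset.sum_mul, Real.negMulLog, neg_mul]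

theorem continuousOn_mutualInfo {p : A → ℝ} (hp : ∀ a, 0 ≤ p a) :
    ContinuousOn (mutualInfo (Y := Y) p) {W | ∀ a, W a ∈ stdSimplex ℝ Y} := by
  have h : Continuous fun W : A → Y → ℝ => ∑ y, Real.negMulLog (∑ a, p a * W a y) -
      ∑ a, ∑ y, p a * Real.negMulLog (W a y) := by
    have := Real.continuous_negMulLog
    fun_prop
  exact h.continuousOn.congr fun W hW => mutualInfo_eq hp fun a => (hW a).1

end MutualInformation

theorem isCompact_channels {A Y : Type*} [Fintype Y] :
    IsCompact {W : A → Y → ℝ | ∀ a, W a ∈ stdSimplex ℝ Y} := by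
  have := isCompact_univ_pi (X := fun _ : A => Y → ℝ) fun _ => isCompact_stdSimplex ℝ Y
  simpa [Set.pi] using this


/-! ### The source coding theorem for an IID source. -/

section SourceCoding

variable {A Y : Type*} [Fintype A]

/-- The expected distortion of a codebook for an IID source with distribution `p`. -/
noncomputable def sourceDistortion (p : A → ℝ) (ρ : A → Y → ℝ) {n : ℕ} (B : Finset (Fin n → Y))
    (hB : B.Nonempty) : ℝ :=
  ∑ v : Fin n → A, (∏ k, p (v k)) * codebookDistortion ρ B hB v

variable [Fintype Y]

/-- Averaging the joint law of letters and codeword letters over the block yields a channel. -/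
theorem exists_average_channel [Nonempty Y] {p : A → ℝ} (hp : p ∈ stdSimplex ℝ A) {n : ℕ}
    (hn : 1 ≤ n) (f : (Fin n → A) → Fin n → Y) :
    ∃ W : A → Y → ℝ, (∀ a, W a ∈ stdSimplex ℝ Y) ∧
      (∀ φ : A → Y → ℝ, n * ∑ a, ∑ y, p a * W a y * φ a y =
        ∑ v : Fin n → A, (∏ k, p (v k)) * ∑ k, φ (v k) (f v k)) ∧
      ∀ v : Fin n → A, 0 < ∏ k, p (v k) → ∀ k, 0 < W (v k) (f v k) := by
  classical
  have hn0 : (0 : ℝ) < n := by exact_mod_cast hn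
  -- The joint law of `(v k, f v k)` when the time `k` is uniform and independent of the source; `W`
  -- will be its conditional law.
  set J : A → Y → ℝ := fun a y => (1 / (n : ℝ)) * ∑ v : Fin n → A, (∏ k, p (v k)) *
    ∑ k, if v k = a ∧ f v k = y then 1 else 0 with hJ
  have hpv : ∀ v : Fin n → A, 0 ≤ ∏ k, p (v k) := fun v => Finset.prod_nonneg fun k _ => hp.1 _
  have hJ0 : ∀ a y, 0 ≤ J a y := fun a y => mul_nonneg (by positivity)
    (Finset.sum_nonneg fun v _ => mul_nonneg (hpv v)
      (Finset.sum_nonneg fun k _ => by split_ifs <;> norm_num))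
  have hJφ : ∀ φ : A → Y → ℝ, n * ∑ a, ∑ y, J a y * φ a y =
      ∑ v : Fin n → A, (∏ k, p (v k)) * ∑ k, φ (v k) (f v k) := by
    intro φ
    have h1 : ∀ a y, n * (J a y * φ a y) = ∑ v : Fin n → A, ∑ k,
        (∏ k, p (v k)) * if v k = a ∧ f v k = y then φ a y else 0 := by
      intro a y
      rw [hJ]
      field_simp
      rw [Finset.sum_mul]
      refine Finset.sum_congr rfl fun v _ => ?_
      rw [mul_assoc, Finset.sum_mul, Finset.mul_sum]
      refine Finset.sum_congr rfl fun k _ => ?_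
      split_ifs <;> simp
    simp_rw [Finset.mul_sum, h1]
    simp_rw [Finset.sum_comm (t := (Finset.univ : Finset (Fin n → A)))]
    refine Finset.sum_congr rfl fun v _ => ?_
    simp_rw [Finset.sum_comm (t := (Finset.univ : Finset (Fin n)))]
    refine Finset.sum_congr rfl fun k _ => ?_
    simp [ite_and]
  have hJrow : ∀ a, ∑ y, J a y = p a := by
    intro a
    have h := hJφ fun a' _ => if a' = a then 1 else 0
    simp only [mul_ite, mul_one, mul_zero] at h
    rw [Finset.sum_comm] at h
    simp only [Finset.sum_ite_eq', Finset.mem_univ, if_true] at h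
    have h2 : ∀ k : Fin n, ∑ v : Fin n → A, (∏ j, p (v j)) * (if v k = a then 1 else 0) = p a := by
      intro k
      rw [sum_prod_mul_eval hp.2 (fun a' => if a' = a then 1 else 0) k]
      simp
    simp_rw [Finset.mul_sum] at h
    rw [Finset.sum_comm, Finset.sum_congr rfl fun k _ => h2 k] at h
    simp only [Finset.sum_const, Finset.card_univ, Fintype.card_fin, nsmul_eq_mul,
      ← Finset.mul_sum] at h
    exact mul_left_cancel₀ hn0.ne' h
  obtain ⟨y₀⟩ := ‹Nonempty Y›
  -- Rows of probability zero are arbitrary; a point mass keeps them stochastic.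
  refine ⟨fun a => if p a = 0 then Pi.single y₀ 1 else fun y => J a y / p a, ?_, ?_, ?_⟩
  · intro a
    by_cases h : p a = 0
    · simp only [h, if_true]
      exact single_mem_stdSimplex ℝ y₀
    · simp only [h, if_false]
      refine ⟨fun y => div_nonneg (hJ0 a y) (hp.1 a), ?_⟩
      rw [← Finset.sum_div, hJrow, div_self h]
  · intro φ
    rw [← hJφ]
    congr 1
    refine Finset.sum_congr rfl fun a _ => Finset.sum_congr rfl fun y _ => ?_
    congr 1
    by_cases h : p a = 0
    · have h0 : ∑ y, J a y = 0 := by rw [hJrow, h]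
      rw [(Finset.sum_eq_zero_iff_of_nonneg fun y _ => hJ0 a y).1 h0 y (Finset.mem_univ y), h,
        zero_mul]
    · simp only [h, if_false]
      field_simp
  · intro v hv k
    have hpk : 0 < p (v k) := lt_of_le_of_ne (hp.1 _) fun h =>
      hv.ne' (Finset.prod_eq_zero (Finset.mem_univ k) h.symm)
    simp only [hpk.ne', if_false]
    refine div_pos (mul_pos (by positivity) ?_) hpk
    refine Finset.sum_pos' (fun w _ => mul_nonneg (hpv w)
      (Finset.sum_nonneg fun k _ => by split_ifs <;> norm_num)) ⟨v, Finset.mem_univ v, ?_⟩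
    refine mul_pos hv (Finset.sum_pos' (fun j _ => by split_ifs <;> norm_num)
      ⟨k, Finset.mem_univ k, by simp⟩)

/-- Converse of the source coding theorem. -/
theorem exists_channel_of_codebook [Nonempty Y] {p : A → ℝ} (hp : p ∈ stdSimplex ℝ A)
    {ρ : A → Y → ℝ} {n : ℕ} (hn : 1 ≤ n) {B : Finset (Fin n → Y)} (hB : B.Nonempty) {D : ℝ}
    (hD : sourceDistortion p ρ B hB ≤ D) :
    ∃ W ∈ feasibleChannels p ρ D, n * mutualInfo p W ≤ Real.log B.card := by
  have hn0 : (0 : ℝ) < n := by exact_mod_cast hn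
  have hmin : ∀ v : Fin n → A, ∃ y ∈ B, blockDistortion ρ v y = codebookDistortion ρ B hB v := by
    intro v
    obtain ⟨y, hy, h⟩ := B.exists_mem_eq_inf' hB (blockDistortion ρ v)
    exact ⟨y, hy, h.symm⟩
  choose f hfB hf using hmin
  obtain ⟨W, hW, hWφ, hWpos⟩ := exists_average_channel hp hn f
  have hpv : ∀ v : Fin n → A, 0 ≤ ∏ k, p (v k) := fun v => Finset.prod_nonneg fun k _ => hp.1 _
  refine ⟨W, ⟨hW, ?_⟩, ?_⟩
  · refine le_trans (le_of_eq ?_) hD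
    have h := hWφ ρ
    rw [← mul_right_inj' hn0.ne', h, sourceDistortion, Finset.mul_sum]
    refine Finset.sum_congr rfl fun v _ => ?_
    rw [← hf, blockDistortion]
    field_simp
  set q : Y → ℝ := fun y => ∑ a, p a * W a y with hq
  have hq0 : ∀ y, 0 ≤ q y := output_nonneg hp.1 fun a => (hW a).1
  have hcard : (0 : ℝ) < B.card := by exact_mod_cast hB.card_pos
  -- The likelihood ratio of the product channel to the product output law. For each fixed `y` its
  -- source average is at most 1; it is not always equal to 1, since a letter with `q (y k) = 0`
  -- makes it 0.
  set L : (Fin n → A) → (Fin n → Y) → ℝ := fun v y => ∏ k, W (v k) (y k) / q (y k) with hL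
  have hL0 : ∀ v y, 0 ≤ L v y := fun v y =>
    Finset.prod_nonneg fun k _ => div_nonneg ((hW _).1 _) (hq0 _)
  have hsumL : ∀ y, ∑ v, (∏ k, p (v k)) * L v y ≤ 1 := by
    intro y
    have h := sum_prod_eq_prod_sum (n := n) fun k a => p a * (W a (y k) / q (y k))
    simp only [Finset.prod_mul_distrib] at h
    rw [h]
    refine Finset.prod_le_one (fun k _ => Finset.sum_nonneg fun a _ =>
      mul_nonneg (hp.1 a) (div_nonneg ((hW _).1 _) (hq0 _))) fun k _ => ?_
    simp_rw [← mul_div_assoc, ← Finset.sum_div]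
    exact div_self_le_one _
  calc n * mutualInfo p W
      = ∑ v : Fin n → A, (∏ k, p (v k)) * ∑ k, Real.log (W (v k) (f v k) / q (f v k)) :=
        hWφ fun a y => Real.log (W a y / q y)
    _ ≤ ∑ v : Fin n → A, (∏ k, p (v k)) *
          ((∑ y ∈ B, L v y) / B.card + (Real.log B.card - 1)) := by
        refine Finset.sum_le_sum fun v _ => ?_
        rcases (hpv v).eq_or_lt with h0 | h0
        · simp [← h0]
        refine mul_le_mul_of_nonneg_left ?_ h0.le
        have hpos : ∀ k, 0 < W (v k) (f v k) / q (f v k) := by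
          intro k
          have hpk : 0 < p (v k) := lt_of_le_of_ne (hp.1 _) fun h =>
            h0.ne' (Finset.prod_eq_zero (Finset.mem_univ k) h.symm)
          exact div_pos (hWpos v h0 k)
            (output_pos hp.1 (fun a => (hW a).1) (mul_pos hpk (hWpos v h0 k)))
        have hLpos : 0 < L v (f v) := Finset.prod_pos fun k _ => hpos k
        rw [← Real.log_prod fun k _ => (hpos k).ne']
        -- `log x ≤ x - 1` at `x = L / |B|` replaces the entropy chain rule: once the chosen
        -- codeword's term is enlarged to the sum over `B`, the average of `x` is at most 1.
        have h1 := Real.log_le_sub_one_of_pos (div_pos hLpos hcard)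
        rw [Real.log_div hLpos.ne' hcard.ne'] at h1
        have h2 : L v (f v) / B.card ≤ (∑ y ∈ B, L v y) / B.card :=
          div_le_div_of_nonneg_right
            (Finset.single_le_sum (f := fun y => L v y) (fun y _ => hL0 v y) (hfB v)) hcard.le
        linarith
    _ = (∑ y ∈ B, ∑ v, (∏ k, p (v k)) * L v y) / B.card + (Real.log B.card - 1) := by
        simp_rw [mul_add, Finset.sum_add_distrib, ← Finset.sum_mul, sum_prod_eq_one hp.2, one_mul]
        rw [Finset.sum_comm, Finset.sum_div]
        congr 1
        exact Finset.sum_congr rfl fun v _ => by rw [← mul_div_assoc, Finset.mul_sum]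
    _ ≤ 1 + (Real.log B.card - 1) := by
        gcongr
        rw [div_le_one hcard]
        calc ∑ y ∈ B, ∑ v, (∏ k, p (v k)) * L v y ≤ ∑ y ∈ B, (1 : ℝ) :=
              Finset.sum_le_sum fun y _ => hsumL y
          _ = B.card := by simp
    _ = Real.log B.card := by ring

/-- A union bound: a pair of positive probability leaves the covering relation only through too
large a distortion or too large an information density. Both are sums over the letters, ready for
the Chernoff bound. -/
theorem sum_atypical_le {p : A → ℝ} (hp : p ∈ stdSimplex ℝ A) (ρ : A → Y → ℝ) {W : A → Y → ℝ}
    (hW : ∀ a, W a ∈ stdSimplex ℝ Y) (D r : ℝ) {n : ℕ} (hn : 1 ≤ n) :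
    ∑ v : Fin n → A, ∑ u : Fin n → Y, (∏ k, p (v k)) * (∏ k, W (v k) (u k)) *
        (if blockDistortion ρ v u ≤ D ∧
          ∏ k, W (v k) (u k) ≤ Real.exp (n * r) * ∏ k, ∑ a, p a * W a (u k) then 0 else 1) ≤
      ∑ w : Fin n → A × Y, (∏ k, p (w k).1 * W (w k).1 (w k).2) *
        (if 0 < ∑ k, (ρ (w k).1 (w k).2 - D) then 1 else 0) +
      ∑ w : Fin n → A × Y, (∏ k, p (w k).1 * W (w k).1 (w k).2) *
        (if 0 < ∑ k, (Real.log (W (w k).1 (w k).2 / ∑ a, p a * W a (w k).2) - r) then 1 else 0) := by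
  have hn0 : (0 : ℝ) < n := by exact_mod_cast hn
  rw [← Fintype.sum_prod_type', ← Finset.sum_add_distrib,
    ← (Equiv.arrowProdEquivProdArrow (Fin n) (fun _ => A) (fun _ => Y)).sum_comp]
  refine Finset.sum_le_sum fun w _ => ?_
  simp only [Equiv.arrowProdEquivProdArrow_apply]
  rw [← Finset.prod_mul_distrib, ← mul_add]
  have hterm : ∀ k, 0 ≤ p (w k).1 * W (w k).1 (w k).2 := fun k => mul_nonneg (hp.1 _) ((hW _).1 _)
  rcases (Finset.prod_nonneg fun k (_ : k ∈ Finset.univ) => hterm k).eq_or_lt with h0 | h0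
  · simp [← h0]
  refine mul_le_mul_of_nonneg_left ?_ h0.le
  split_ifs with hT h1 h2 h2 h1 h2 h2 <;> try norm_num
  refine hT ⟨?_, ?_⟩
  · rw [Finset.sum_sub_distrib] at h1
    simp only [Finset.sum_const, Finset.card_univ, Fintype.card_fin, nsmul_eq_mul] at h1
    rw [blockDistortion, one_div, inv_mul_le_iff₀ hn0]
    linarith
  · have hpos : ∀ k, 0 < p (w k).1 * W (w k).1 (w k).2 := fun k => lt_of_le_of_ne (hterm k) fun h =>
      h0.ne' (Finset.prod_eq_zero (Finset.mem_univ k) h.symm)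
    have hq : ∀ k, 0 < ∑ a, p a * W a (w k).2 := fun k =>
      output_pos hp.1 (fun a => (hW a).1) (hpos k)
    have hWk : ∀ k, 0 < W (w k).1 (w k).2 := fun k =>
      lt_of_le_of_ne ((hW _).1 _) fun h => (hpos k).ne' (by rw [← h, mul_zero])
    rw [Finset.sum_sub_distrib] at h2
    simp only [Finset.sum_const, Finset.card_univ, Fintype.card_fin, nsmul_eq_mul] at h2
    rw [← div_le_iff₀ (Finset.prod_pos fun k _ => hq k), ← Finset.prod_div_distrib,
      ← Real.exp_log (Finset.prod_pos fun k _ => div_pos (hWk k) (hq k)), Real.exp_le_exp,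
      Real.log_prod fun k _ => (div_pos (hWk k) (hq k)).ne']
    linarith

theorem tendsto_sum_atypical {p : A → ℝ} (hp : p ∈ stdSimplex ℝ A) {W : A → Y → ℝ}
    (hW : ∀ a, W a ∈ stdSimplex ℝ Y) (φ : A → Y → ℝ) {t : ℝ}
    (h : ∑ a, ∑ y, p a * W a y * φ a y < t) :
    Tendsto (fun n : ℕ => ∑ w : Fin n → A × Y, (∏ k, p (w k).1 * W (w k).1 (w k).2) *
      (if 0 < ∑ k, (φ (w k).1 (w k).2 - t) then 1 else 0)) atTop (𝓝 (0 : ℝ)) := by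
  have hsum : ∑ x : A × Y, p x.1 * W x.1 x.2 = 1 := by
    rw [Fintype.sum_prod_type]
    simp_rw [← Finset.mul_sum, (hW _).2, mul_one, hp.2]
  refine tendsto_sum_prod_indicator (r := fun x : A × Y => p x.1 * W x.1 x.2)
    (g := fun x => φ x.1 x.2 - t) (fun x => mul_nonneg (hp.1 _) ((hW _).1 _)) hsum ?_
  simp_rw [mul_sub, Finset.sum_sub_distrib, ← Finset.sum_mul, hsum]
  rw [Fintype.sum_prod_type]
  linarith

/-- Achievability part of the source coding theorem. -/
theorem eventually_exists_codebook {p : A → ℝ} (hp : p ∈ stdSimplex ℝ A) {ρ : A → Y → ℝ}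
    (hρ : ∀ a y, 0 ≤ ρ a y) {W : A → Y → ℝ} (hW : ∀ a, W a ∈ stdSimplex ℝ Y) {D r : ℝ}
    (hD : ∑ a, ∑ y, p a * W a y * ρ a y < D) (hr : mutualInfo p W < r) :
    ∀ᶠ n : ℕ in atTop, ∃ (B : Finset (Fin n → Y)) (hB : B.Nonempty),
      B.card ≤ ⌈Real.exp (n * r)⌉₊ ∧ sourceDistortion p ρ B hB ≤ D := by
  classical
  -- The gap `D - D'` absorbs `M` times the failure probability; the gap `r - s` makes the ratio of
  -- codebook size to domination constant at least `exp (n * (r - s))`.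
  obtain ⟨D', hDD', hD'D⟩ := exists_between hD
  obtain ⟨s, hIs, hsr⟩ := exists_between hr
  have hD'0 : 0 ≤ D' := le_trans (Finset.sum_nonneg fun a _ => Finset.sum_nonneg fun y _ =>
    mul_nonneg (mul_nonneg (hp.1 a) ((hW a).1 y)) (hρ a y)) hDD'.le
  set M : ℝ := ∑ a, ∑ y, ρ a y with hM
  have hρM : ∀ a y, ρ a y ≤ M := fun a y =>
    (Finset.single_le_sum (f := ρ a) (fun y _ => hρ a y) (Finset.mem_univ y)).trans
      (Finset.single_le_sum (f := fun a => ∑ y, ρ a y)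
        (fun a _ => Finset.sum_nonneg fun y _ => hρ a y) (Finset.mem_univ a))
  have hM0 : 0 ≤ M := Finset.sum_nonneg fun a _ => Finset.sum_nonneg fun y _ => hρ a y
  have h1 := tendsto_sum_atypical hp hW ρ hDD'
  have h2 := tendsto_sum_atypical hp hW (fun a y => Real.log (W a y / ∑ a', p a' * W a' y)) hIs
  have h3 : Tendsto (fun n : ℕ => Real.exp (-Real.exp (n * (r - s)))) atTop (𝓝 0) :=
    Real.tendsto_exp_neg_atTop_nhds_zero.comp (Real.tendsto_exp_atTop.comp
      (tendsto_natCast_atTop_atTop.atTop_mul_const (sub_pos.2 hsr)))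
  have h4 := (((h1.add h2).add h3).const_mul M).const_add D'
  simp only [add_zero, mul_zero] at h4
  filter_upwards [h4.eventually (gt_mem_nhds hD'D), eventually_ge_atTop 1] with n hlt hn
  have hn0 : (0 : ℝ) < n := by exact_mod_cast hn
  have hprodp : (fun v : Fin n → A => ∏ k, p (v k)) ∈ stdSimplex ℝ (Fin n → A) :=
    ⟨fun v => Finset.prod_nonneg fun k _ => hp.1 _, sum_prod_eq_one hp.2⟩
  have hq := output_mem_stdSimplex hp hW
  have hprodq : (fun u : Fin n → Y => ∏ k, ∑ a, p a * W a (u k)) ∈ stdSimplex ℝ (Fin n → Y) :=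
    ⟨fun u => Finset.prod_nonneg fun k _ => hq.1 _, sum_prod_eq_one hq.2⟩
  have hprodW : ∀ v : Fin n → A, (fun u : Fin n → Y => ∏ k, W (v k) (u k)) ∈
      stdSimplex ℝ (Fin n → Y) := fun v =>
    ⟨fun u => Finset.prod_nonneg fun k _ => (hW _).1 _, by
      rw [sum_prod_eq_prod_sum fun k => W (v k)]
      simp [(hW _).2]⟩
  obtain ⟨C, hC⟩ := exists_covering (T := fun (v : Fin n → A) (u : Fin n → Y) =>
    blockDistortion ρ v u ≤ D' ∧
      ∏ k, W (v k) (u k) ≤ Real.exp (n * s) * ∏ k, ∑ a, p a * W a (u k))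
    hprodp hprodq hprodW (Real.exp_pos (n * s)) (fun v _ u h => h.2) ⌈Real.exp (n * r)⌉₊
  have hN : 0 < ⌈Real.exp (n * r)⌉₊ := Nat.ceil_pos.2 (Real.exp_pos _)
  refine ⟨Finset.univ.image C, ⟨C ⟨0, hN⟩, by simp⟩, ?_, ?_⟩
  · exact Finset.card_image_le.trans (by simp)
  have hexp : Real.exp (-((⌈Real.exp (n * r)⌉₊ : ℝ) / Real.exp (n * s))) ≤
      Real.exp (-Real.exp (n * (r - s))) := by
    rw [Real.exp_le_exp, neg_le_neg_iff, le_div_iff₀ (Real.exp_pos _), ← Real.exp_add]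
    refine le_trans (le_of_eq ?_) (Nat.le_ceil _)
    ring_nf
  have hfail := hC.trans (add_le_add (sum_atypical_le hp ρ hW D' s hn) hexp)
  refine le_trans ?_ ((add_le_add_right (mul_le_mul_of_nonneg_left hfail hM0) D').trans hlt.le)
  calc sourceDistortion p ρ (Finset.univ.image C) _
      ≤ ∑ v : Fin n → A, (∏ k, p (v k)) * (D' + M * (if ∀ i, ¬ (blockDistortion ρ v (C i) ≤ D' ∧
          ∏ k, W (v k) (C i k) ≤ Real.exp (n * s) * ∏ k, ∑ a, p a * W a (C i k))
            then 1 else 0)) := by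
        refine Finset.sum_le_sum fun v _ => mul_le_mul_of_nonneg_left ?_ (hprodp.1 v)
        split_ifs with h
        · refine (Finset.inf'_le _ (Finset.mem_image_of_mem C (Finset.mem_univ ⟨0, hN⟩))).trans ?_
          rw [blockDistortion, one_div, inv_mul_le_iff₀ hn0]
          calc ∑ k, ρ (v k) (C ⟨0, hN⟩ k) ≤ ∑ _k : Fin n, M := Finset.sum_le_sum fun k _ => hρM _ _
            _ = n * M := by simp
            _ ≤ n * (D' + M * 1) := by gcongr; linarith
        · push Not at h
          obtain ⟨i, hi, -⟩ := h
          refine (Finset.inf'_le _ (Finset.mem_image_of_mem C (Finset.mem_univ i))).trans ?_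
          linarith
    _ = _ := by
        simp_rw [mul_add, Finset.sum_add_distrib, ← Finset.sum_mul, sum_prod_eq_one hp.2, one_mul,
          Finset.mul_sum]
        congr 1
        exact Finset.sum_congr rfl fun v _ => by ring

end SourceCoding


/-! ### The rate-distortion function: right continuity and behaviour around the minimal distortion.
-/

section RateDistortion

variable {A Y : Type*} [Fintype A] [Fintype Y]

theorem exists_channel_of_iidRateDistortion_lt {p : A → ℝ} {ρ : A → Y → ℝ} {D : ℝ} {c : EReal}
    (h : iidRateDistortion p ρ D < c) :
    ∃ W ∈ feasibleChannels p ρ D, (mutualInfo p W : EReal) < c := by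
  simpa [iidRateDistortion, iInf_lt_iff] using h

theorem iidRateDistortion_le {p : A → ℝ} {ρ : A → Y → ℝ} {D : ℝ} {W : A → Y → ℝ}
    (hW : W ∈ feasibleChannels p ρ D) : iidRateDistortion p ρ D ≤ mutualInfo p W :=
  iInf₂_le W hW

theorem iidRateDistortion_antitone (p : A → ℝ) (ρ : A → Y → ℝ) :
    Antitone (iidRateDistortion p ρ) := fun _ _ h =>
  biInf_mono fun _ hW => ⟨hW.1, hW.2.trans h⟩

theorem iidRateDistortion_nonneg {p : A → ℝ} (hp : p ∈ stdSimplex ℝ A) (ρ : A → Y → ℝ) (D : ℝ) :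
    0 ≤ iidRateDistortion p ρ D :=
  le_iInf₂ fun _ hW => EReal.coe_nonneg.2 (mutualInfo_nonneg hp hW.1)

theorem continuous_channelDistortion (p : A → ℝ) (ρ : A → Y → ℝ) :
    Continuous fun W : A → Y → ℝ => ∑ a, ∑ y, p a * W a y * ρ a y := by
  fun_prop

/-- The rate-distortion function is continuous from the right. -/
theorem iidRateDistortion_tendsto_nhdsGT {p : A → ℝ} (hp : p ∈ stdSimplex ℝ A) (ρ : A → Y → ℝ)
    (D : ℝ) : Tendsto (iidRateDistortion p ρ) (𝓝[>] D) (𝓝 (iidRateDistortion p ρ D)) := by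
  refine tendsto_order.2 ⟨fun a ha => ?_, fun b hb => ?_⟩
  · suffices ∃ D₁ > D, a < iidRateDistortion p ρ D₁ by
      obtain ⟨D₁, hD₁, h⟩ := this
      filter_upwards [Ioo_mem_nhdsGT hD₁] with x hx
      exact h.trans_le (iidRateDistortion_antitone p ρ hx.2.le)
    -- Otherwise channels feasible at `D + 1 / (n + 1)` have information below some `c` smaller than
    -- the value at `D`; a limit point of them is feasible at `D` with information at most `c`.
    by_contra! hle
    obtain ⟨c, hac, hc⟩ := EReal.lt_iff_exists_real_btwn.1 ha
    have hlim : Tendsto (fun n : ℕ => D + 1 / ((n : ℝ) + 1)) atTop (𝓝 D) := by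
      simpa using tendsto_one_div_add_atTop_nhds_zero_nat.const_add D
    have hex : ∀ n : ℕ, ∃ W ∈ feasibleChannels p ρ (D + 1 / ((n : ℝ) + 1)),
        (mutualInfo p W : EReal) < c := fun n =>
      exists_channel_of_iidRateDistortion_lt
        ((hle _ (lt_add_of_pos_right D Nat.one_div_pos_of_nat)).trans_lt hac)
    choose W hW hI using hex
    obtain ⟨W', hW', φ, hφ, hWφ⟩ := isCompact_channels.tendsto_subseq fun n => (hW n).1
    have hfeas : W' ∈ feasibleChannels p ρ D := ⟨hW', le_of_tendsto_of_tendsto'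
      (((continuous_channelDistortion p ρ).tendsto W').comp hWφ) (hlim.comp hφ.tendsto_atTop)
      fun n => (hW (φ n)).2⟩
    have hI' : mutualInfo p W' ≤ c := by
      refine le_of_tendsto' (((continuousOn_mutualInfo hp.1) W' hW').tendsto.comp
        (tendsto_nhdsWithin_iff.2 ⟨hWφ, Eventually.of_forall fun n => (hW (φ n)).1⟩)) fun n => ?_
      exact (EReal.coe_lt_coe_iff.1 (hI (φ n))).le
    exact absurd ((iidRateDistortion_le hfeas).trans (EReal.coe_le_coe_iff.2 hI')) (not_le.2 hc)
  · filter_upwards [self_mem_nhdsWithin] with x hx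
    exact (iidRateDistortion_antitone p ρ (le_of_lt hx)).trans_lt hb

variable [Nonempty Y]

theorem minDistortion_le {p : A → ℝ} (hp : ∀ a, 0 ≤ p a) (ρ : A → Y → ℝ) {W : A → Y → ℝ}
    (hW : ∀ a, W a ∈ stdSimplex ℝ Y) :
    minDistortion p ρ ≤ ∑ a, ∑ y, p a * W a y * ρ a y := by
  refine Finset.sum_le_sum fun a _ => ?_
  simp_rw [mul_assoc, ← Finset.mul_sum]
  refine mul_le_mul_of_nonneg_left ?_ (hp a)
  rw [← one_mul (Finset.univ.inf' _ _), ← (hW a).2, Finset.sum_mul]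
  exact Finset.sum_le_sum fun y _ =>
    mul_le_mul_of_nonneg_left (Finset.inf'_le _ (Finset.mem_univ y)) ((hW a).1 y)

theorem exists_channel_minDistortion (p : A → ℝ) (ρ : A → Y → ℝ) :
    ∃ W : A → Y → ℝ, (∀ a, W a ∈ stdSimplex ℝ Y) ∧
      ∑ a, ∑ y, p a * W a y * ρ a y = minDistortion p ρ := by
  classical
  choose f _ hf using fun a => Finset.univ.exists_mem_eq_inf' Finset.univ_nonempty (ρ a)
  refine ⟨fun a => Pi.single (f a) 1, fun a => single_mem_stdSimplex ℝ _, ?_⟩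
  simp [minDistortion, hf, Pi.single_apply]

theorem iidRateDistortion_eq_top {p : A → ℝ} (hp : ∀ a, 0 ≤ p a) {ρ : A → Y → ℝ} {D : ℝ}
    (hD : D < minDistortion p ρ) : iidRateDistortion p ρ D = ⊤ :=
  iInf₂_eq_top.2 fun _ hW => absurd ((minDistortion_le hp ρ hW.1).trans hW.2) (not_le.2 hD)

theorem iidRateDistortion_lt_top (p : A → ℝ) {ρ : A → Y → ℝ} {D : ℝ}
    (hD : minDistortion p ρ ≤ D) : iidRateDistortion p ρ D < ⊤ := by
  obtain ⟨W, hW, h⟩ := exists_channel_minDistortion p ρ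
  exact (iidRateDistortion_le ⟨hW, h.trans_le hD⟩).trans_lt (EReal.coe_lt_top _)

/-- Above the minimal distortion the distortion constraint can be made strict at an arbitrarily
small cost in mutual information. -/
theorem exists_channel_distortion_lt {p : A → ℝ} (hp : ∀ a, 0 ≤ p a) {ρ : A → Y → ℝ} {D c : ℝ}
    (hD : minDistortion p ρ < D) (h : iidRateDistortion p ρ D < c) :
    ∃ W : A → Y → ℝ, (∀ a, W a ∈ stdSimplex ℝ Y) ∧ ∑ a, ∑ y, p a * W a y * ρ a y < D ∧
      mutualInfo p W < c := by
  obtain ⟨W, hW, hI⟩ := exists_channel_of_iidRateDistortion_lt h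
  obtain ⟨W₀, hW₀, hd₀⟩ := exists_channel_minDistortion p ρ
  -- Any weight `t > 0` on the distortion-minimizing `W₀` makes the constraint strict, and
  -- continuity keeps the information below `c` for small `t`.
  set V : ℝ → A → Y → ℝ := fun t a y => (1 - t) * W a y + t * W₀ a y with hV
  have hVmem : ∀ t ∈ Set.Icc (0 : ℝ) 1, ∀ a, V t a ∈ stdSimplex ℝ Y := fun t ht a =>
    convex_stdSimplex ℝ Y (hW.1 a) (hW₀ a) (sub_nonneg.2 ht.2) ht.1 (by ring)
  have hV0 : V 0 = W := by
    funext a y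
    simp [hV]
  have hcont : Continuous V := by
    rw [hV]
    fun_prop
  have h1 : Tendsto (fun t => mutualInfo p (V t)) (𝓝[>] 0) (𝓝 (mutualInfo p W)) := by
    refine ((continuousOn_mutualInfo hp) W hW.1).tendsto.comp (tendsto_nhdsWithin_iff.2 ⟨?_, ?_⟩)
    · rw [← hV0]
      exact hcont.continuousAt.tendsto.mono_left nhdsWithin_le_nhds
    · filter_upwards [Ioo_mem_nhdsGT (zero_lt_one' ℝ)] with t ht
      exact hVmem t ⟨ht.1.le, ht.2.le⟩
  obtain ⟨t, hlt, ht⟩ := ((h1.eventually (gt_mem_nhds (EReal.coe_lt_coe_iff.1 hI))).and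
    (Ioo_mem_nhdsGT (zero_lt_one' ℝ))).exists
  refine ⟨V t, hVmem t ⟨ht.1.le, ht.2.le⟩, ?_, hlt⟩
  have : ∑ a, ∑ y, p a * V t a y * ρ a y = (1 - t) * ∑ a, ∑ y, p a * W a y * ρ a y +
      t * ∑ a, ∑ y, p a * W₀ a y * ρ a y := by
    simp_rw [Finset.mul_sum, ← Finset.sum_add_distrib]
    refine Finset.sum_congr rfl fun a _ => Finset.sum_congr rfl fun y _ => ?_
    simp only [hV]
    ring
  rw [this, hd₀]
  have := hW.2
  have ht1 := ht.1
  have ht2 := ht.2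
  nlinarith

/-- The full codebook allows the best reproduction letter by letter. This supplies feasible
codebooks at every block length `n ≥ 1`, where random coding supplies them only eventually. -/
theorem sourceDistortion_univ_le {p : A → ℝ} (hp : p ∈ stdSimplex ℝ A) (ρ : A → Y → ℝ) {n : ℕ}
    (hn : 1 ≤ n) : sourceDistortion p ρ (Finset.univ : Finset (Fin n → Y)) Finset.univ_nonempty ≤
      minDistortion p ρ := by
  have hn0 : (0 : ℝ) < n := by exact_mod_cast hn
  choose f _ hf using fun a => Finset.univ.exists_mem_eq_inf' Finset.univ_nonempty (ρ a)
  calc sourceDistortion p ρ (Finset.univ : Finset (Fin n → Y)) Finset.univ_nonempty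
      ≤ ∑ v : Fin n → A, (∏ k, p (v k)) * blockDistortion ρ v fun k => f (v k) :=
        Finset.sum_le_sum fun v _ => mul_le_mul_of_nonneg_left
          (Finset.inf'_le _ (Finset.mem_univ _)) (Finset.prod_nonneg fun k _ => hp.1 _)
    _ = (1 / (n : ℝ)) * ∑ k : Fin n, ∑ v : Fin n → A, (∏ k, p (v k)) * ρ (v k) (f (v k)) := by
        simp_rw [blockDistortion, Finset.mul_sum]
        rw [Finset.sum_comm]
        exact Finset.sum_congr rfl fun k _ => Finset.sum_congr rfl fun v _ => by ring
    _ = minDistortion p ρ := by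
        simp_rw [sum_prod_mul_eval hp.2 fun a => ρ a (f a), minDistortion, hf]
        simp only [Finset.sum_const, Finset.card_univ, Fintype.card_fin, nsmul_eq_mul]
        field_simp

end RateDistortion

/-! ### Reduction of the switcher problem to the source of candidate sets. -/

section CandidateSource

variable {X Y : Type*} [DecidableEq X] {m : ℕ}

/-- The set of the letters that the switcher can choose from. -/
def candidateSet (hm : 1 ≤ m) (x : Fin m → X) : CandidateSet X m :=
  ⟨Finset.univ.image x, ⟨x ⟨0, hm⟩, by simp⟩, Finset.card_image_le.trans (by simp)⟩

theorem candidateDistortion_candidateSet_le (hm : 1 ≤ m) (d : X → Y → ℝ) (x : Fin m → X)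
    (l : Fin m) (y : Y) : candidateDistortion m d (candidateSet hm x) y ≤ d (x l) y :=
  Finset.inf'_le _ (by simp [candidateSet])

theorem exists_candidateDistortion_eq (hm : 1 ≤ m) (d : X → Y → ℝ) (x : Fin m → X) (y : Y) :
    ∃ l, d (x l) y = candidateDistortion m d (candidateSet hm x) y := by
  obtain ⟨a, ha, h⟩ := (candidateSet hm x).1.exists_mem_eq_inf' (candidateSet hm x).2.1
    fun a => d a y
  obtain ⟨l, -, rfl⟩ := Finset.mem_image.1 ha
  exact ⟨l, h.symm⟩

theorem codebookDistortion_candidateSet_le (hm : 1 ≤ m) (d : X → Y → ℝ) {n : ℕ}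
    {B : Finset (Fin n → Y)} (hB : B.Nonempty) (z : Fin n → Fin m → X) (s : Fin n → Fin m) :
    codebookDistortion (candidateDistortion m d) B hB (fun k => candidateSet hm (z k)) ≤
      codebookDistortion d B hB (switchOutput z s) :=
  Finset.inf'_mono_fun fun _ _ => mul_le_mul_of_nonneg_left
    (Finset.sum_le_sum fun k _ => candidateDistortion_candidateSet_le hm d (z k) (s k) _)
    (by positivity)

/-- The switcher aims at the codeword nearest to the candidate sets and at each time selects a
letter attaining the minimum in `ρ`. -/
theorem exists_codebookDistortion_switchOutput_le (hm : 1 ≤ m) (d : X → Y → ℝ) {n : ℕ}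
    {B : Finset (Fin n → Y)} (hB : B.Nonempty) (z : Fin n → Fin m → X) :
    ∃ s, codebookDistortion d B hB (switchOutput z s) ≤
      codebookDistortion (candidateDistortion m d) B hB fun k => candidateSet hm (z k) := by
  obtain ⟨y, hy, h⟩ := B.exists_mem_eq_inf' hB
    (blockDistortion (candidateDistortion m d) fun k => candidateSet hm (z k))
  choose s hs using fun k => exists_candidateDistortion_eq hm d (z k) (y k)
  refine ⟨s, (Finset.inf'_le _ hy).trans (le_of_eq ?_)⟩
  rw [codebookDistortion, h]
  simp [blockDistortion, switchOutput, hs]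

variable [Fintype X]

theorem sum_blockProb_eq_prod_candidateDist (P : (Fin m → X) → ℝ) {n : ℕ}
    (V : Fin n → CandidateSet X m) :
    (∑ z : Fin n → Fin m → X with ∀ k, Finset.univ.image (z k) = (V k).1, blockProb P z) =
      ∏ k, candidateDist P (V k) := by
  have h := sum_prod_eq_prod_sum fun k (x : Fin m → X) =>
    if Finset.univ.image x = (V k).1 then P x else 0
  simp_rw [candidateDist, Finset.sum_filter]
  rw [← h]
  refine Finset.sum_congr rfl fun z _ => ?_
  rw [Finset.prod_ite_zero]
  simp [blockProb]

/-- Change of variables: the realizations `z` are grouped by their sequence of candidate sets. -/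
theorem sum_blockProb_mul (hm : 1 ≤ m) (P : (Fin m → X) → ℝ) {n : ℕ}
    (g : (Fin n → CandidateSet X m) → ℝ) :
    ∑ z : Fin n → Fin m → X, blockProb P z * g (fun k => candidateSet hm (z k)) =
      ∑ V : Fin n → CandidateSet X m, (∏ k, candidateDist P (V k)) * g V := by
  rw [← Finset.sum_fiberwise (s := Finset.univ) (g := fun z k => candidateSet hm (z k))]
  refine Finset.sum_congr rfl fun V _ => ?_
  rw [← sum_blockProb_eq_prod_candidateDist, Finset.sum_mul]
  refine Finset.sum_congr ?_ fun z hz => ?_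
  · ext z
    simp [funext_iff, candidateSet, Subtype.ext_iff]
  · congr 2
    funext k
    exact Subtype.ext ((Finset.mem_filter.1 hz).2 k)

theorem candidateDist_mem_stdSimplex (hm : 1 ≤ m) {P : (Fin m → X) → ℝ}
    (hP : P ∈ stdSimplex ℝ (Fin m → X)) : candidateDist P ∈ stdSimplex ℝ (CandidateSet X m) := by
  refine ⟨fun V => Finset.sum_nonneg fun x _ => hP.1 x, ?_⟩
  rw [← hP.2, ← Finset.sum_fiberwise (s := Finset.univ) (g := candidateSet hm)]
  refine Finset.sum_congr rfl fun V _ => Finset.sum_congr ?_ fun _ _ => rfl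
  ext x
  simp [candidateSet, Subtype.ext_iff]

/-- Feasibility for the helpful switcher is feasibility for the source of candidate sets. -/
theorem helpfulFeasible_iff (hm : 1 ≤ m) {P : (Fin m → X) → ℝ} (hP : ∀ x, 0 ≤ P x)
    (d : X → Y → ℝ) (D : ℝ) {n : ℕ} (B : Finset (Fin n → Y)) :
    HelpfulFeasible P d D B ↔ ∃ hB : B.Nonempty,
      sourceDistortion (candidateDist P) (candidateDistortion m d) B hB ≤ D := by
  have hblock : ∀ z : Fin n → Fin m → X, 0 ≤ blockProb P z := fun z =>
    Finset.prod_nonneg fun k _ => hP _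
  refine exists_congr fun hB => ?_
  rw [sourceDistortion, ← sum_blockProb_mul hm]
  constructor
  · rintro ⟨S, hS, h⟩
    refine le_trans (Finset.sum_le_sum fun z _ => ?_) h
    -- The total mass 1 of `S z` is inserted so that the bound for each switch sequence can be
    -- averaged.
    rw [← mul_one (codebookDistortion _ _ _ _), ← (hS z).2, Finset.mul_sum, Finset.mul_sum]
    refine Finset.sum_le_sum fun s _ => ?_
    rw [mul_assoc, mul_comm (codebookDistortion _ _ _ _)]
    exact mul_le_mul_of_nonneg_left (mul_le_mul_of_nonneg_left
      (codebookDistortion_candidateSet_le hm d hB z s) ((hS z).1 s)) (hblock z)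
  · intro h
    choose s hs using exists_codebookDistortion_switchOutput_le hm d hB
    refine ⟨fun z => Pi.single (s z) 1, fun z => single_mem_stdSimplex ℝ _, le_trans ?_ h⟩
    refine Finset.sum_le_sum fun z _ => ?_
    simp only [Pi.single_apply, mul_ite, mul_one, mul_zero, ite_mul, zero_mul,
      Finset.sum_ite_eq', Finset.mem_univ, if_true]
    exact mul_le_mul_of_nonneg_left (hs z) (hblock z)

end CandidateSource

/-! ### From codebooks to rates and limits. -/

section HelpfulRate

variable {X Y : Type*} [Fintype X] {m : ℕ}

theorem log_natCast_div (k n : ℕ) (hk : k ≠ 0) :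
    ENNReal.log (((k : ℕ∞) : ENNReal)) / (n : EReal) = ((Real.log k / n : ℝ) : EReal) := by
  rw [EReal.coe_div, ENat.toENNReal_coe, ENNReal.log_pos_real (by simpa) (by simp)]
  simp

theorem helpfulRate_le {P : (Fin m → X) → ℝ} {d : X → Y → ℝ} {D : ℝ} {n : ℕ}
    {B : Finset (Fin n → Y)} (hB : HelpfulFeasible P d D B) :
    helpfulRate P d D n ≤ ((Real.log B.card / n : ℝ) : EReal) := by
  rw [← log_natCast_div _ _ hB.1.card_pos.ne']
  refine EReal.div_le_div_right_of_nonneg (by positivity) (ENNReal.log_monotone ?_)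
  exact ENat.toENNReal_mono (iInf₂_le B hB)

theorem exists_helpfulRate_eq [Fintype Y] {P : (Fin m → X) → ℝ} {d : X → Y → ℝ} {D : ℝ} {n : ℕ}
    (h : ∃ B : Finset (Fin n → Y), HelpfulFeasible P d D B) :
    ∃ B : Finset (Fin n → Y), HelpfulFeasible P d D B ∧
      helpfulRate P d D n = ((Real.log B.card / n : ℝ) : EReal) := by
  obtain ⟨B, hB, hmin⟩ := Set.exists_min_image {B : Finset (Fin n → Y) | HelpfulFeasible P d D B}
    Finset.card (Set.toFinite _) h
  refine ⟨B, hB, ?_⟩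
  rw [← log_natCast_div _ _ hB.1.card_pos.ne', helpfulRate]
  congr 3
  exact le_antisymm (iInf₂_le B hB) (le_iInf₂ fun B' hB' => by exact_mod_cast hmin B' hB')

theorem helpfulRate_eq_top {P : (Fin m → X) → ℝ} {d : X → Y → ℝ} {D : ℝ} {n : ℕ} (hn : 1 ≤ n)
    (h : ¬ ∃ B : Finset (Fin n → Y), HelpfulFeasible P d D B) : helpfulRate P d D n = ⊤ := by
  have : helpfulCodebookSize P d D n = ⊤ := iInf₂_eq_top.2 fun B hB => absurd ⟨B, hB⟩ h
  rw [helpfulRate, this, ENat.toENNReal_top, ENNReal.log_top]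
  -- Here `n ≥ 1` matters, because `⊤ / 0 = 0` in `EReal`.
  exact EReal.top_div_of_pos_ne_top (by exact_mod_cast hn) (EReal.natCast_ne_top n)

variable [DecidableEq X] [Fintype Y] [Nonempty Y]

theorem iidRateDistortion_le_helpfulRate (hm : 1 ≤ m) {P : (Fin m → X) → ℝ}
    (hP : P ∈ stdSimplex ℝ (Fin m → X)) (d : X → Y → ℝ) (D : ℝ) {n : ℕ} (hn : 1 ≤ n) :
    iidRateDistortion (candidateDist P) (candidateDistortion m d) D ≤ helpfulRate P d D n := by
  by_cases h : ∃ B : Finset (Fin n → Y), HelpfulFeasible P d D B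
  · obtain ⟨B, hB, heq⟩ := exists_helpfulRate_eq h
    obtain ⟨hB0, hBD⟩ := (helpfulFeasible_iff hm hP.1 d D B).1 hB
    obtain ⟨W, hW, hI⟩ :=
      exists_channel_of_codebook (candidateDist_mem_stdSimplex hm hP) hn hB0 hBD
    rw [heq]
    refine (iidRateDistortion_le hW).trans (EReal.coe_le_coe_iff.2 ?_)
    rw [le_div_iff₀ (by exact_mod_cast hn)]
    linarith
  · rw [helpfulRate_eq_top hn h]
    exact le_top

theorem eventually_helpfulRate_lt (hm : 1 ≤ m) {P : (Fin m → X) → ℝ}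
    (hP : P ∈ stdSimplex ℝ (Fin m → X)) {d : X → Y → ℝ} (hd : ∀ x y, 0 ≤ d x y) {D c : ℝ}
    (hD : minDistortion (candidateDist P) (candidateDistortion m d) < D)
    (hc : iidRateDistortion (candidateDist P) (candidateDistortion m d) D < c) :
    ∀ᶠ n in atTop, helpfulRate P d D n < c := by
  have hp := candidateDist_mem_stdSimplex hm hP
  obtain ⟨W, hW, hWD, hI⟩ := exists_channel_distortion_lt hp.1 hD hc
  obtain ⟨r, hIr, hrc⟩ := exists_between hI
  have hr0 : 0 ≤ r := (mutualInfo_nonneg hp hW).trans hIr.le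
  have hlim : Tendsto (fun n : ℕ => Real.log 2 / n + r) atTop (𝓝 r) := by
    simpa using (tendsto_const_div_atTop_nhds_zero_nat (Real.log 2)).add_const r
  filter_upwards [eventually_exists_codebook hp
    (fun V y => Finset.le_inf' _ _ fun x _ => hd x y) hW hWD hIr,
    hlim.eventually (gt_mem_nhds hrc), eventually_ge_atTop 1] with n hn hlt hn1
  obtain ⟨B, hB, hcard, hBD⟩ := hn
  have hn0 : (0 : ℝ) < n := by exact_mod_cast hn1
  refine (helpfulRate_le ((helpfulFeasible_iff hm hP.1 d D B).2 ⟨hB, hBD⟩)).trans_lt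
    (EReal.coe_lt_coe_iff.2 (lt_of_le_of_lt ?_ hlt))
  -- Since `r ≥ 0`, rounding up costs at most a factor 2, hence a vanishing `log 2 / n` in the rate.
  have hcard' : (B.card : ℝ) ≤ 2 * Real.exp (n * r) := by
    have h1 : (B.card : ℝ) ≤ (⌈Real.exp (n * r)⌉₊ : ℝ) := by exact_mod_cast hcard
    have h2 := Nat.ceil_lt_add_one (Real.exp_pos (n * r)).le
    have h3 : 1 ≤ Real.exp (n * r) := Real.one_le_exp (by positivity)
    linarith
  have hlog := Real.log_le_log (by exact_mod_cast hB.card_pos) hcard'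
  rw [Real.log_mul two_ne_zero (Real.exp_pos _).ne', Real.log_exp] at hlog
  rw [div_le_iff₀ hn0, add_mul, div_mul_cancel₀ _ hn0.ne']
  linarith

theorem tendsto_helpfulRate (hm : 1 ≤ m) {P : (Fin m → X) → ℝ}
    (hP : P ∈ stdSimplex ℝ (Fin m → X)) {d : X → Y → ℝ} (hd : ∀ x y, 0 ≤ d x y) {D : ℝ}
    (hD : D ≠ minDistortion (candidateDist P) (candidateDistortion m d)) :
    Tendsto (helpfulRate P d D) atTop
      (𝓝 (iidRateDistortion (candidateDist P) (candidateDistortion m d) D)) := by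
  refine tendsto_order.2 ⟨fun a ha => ?_, fun b hb => ?_⟩
  · filter_upwards [eventually_ge_atTop 1] with n hn
    exact ha.trans_le (iidRateDistortion_le_helpfulRate hm hP d D hn)
  · rcases hD.lt_or_gt with h | h
    · rw [iidRateDistortion_eq_top (candidateDist_mem_stdSimplex hm hP).1 h] at hb
      exact absurd hb not_top_lt
    · obtain ⟨c, hc, hcb⟩ := EReal.lt_iff_exists_real_btwn.1 hb
      filter_upwards [eventually_helpfulRate_lt hm hP hd h hc] with n hn
      exact hn.trans hcb

theorem isLeast_helpfulAchievable (hm : 1 ≤ m) {P : (Fin m → X) → ℝ}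
    (hP : P ∈ stdSimplex ℝ (Fin m → X)) {d : X → Y → ℝ} (hd : ∀ x y, 0 ≤ d x y) {D : ℝ}
    (hD : minDistortion (candidateDist P) (candidateDistortion m d) < D) :
    IsLeast (Real.toEReal '' {R : ℝ | HelpfulAchievable P d D R})
      (iidRateDistortion (candidateDist P) (candidateDistortion m d) D) := by
  have hp := candidateDist_mem_stdSimplex hm hP
  -- Above the minimal distortion the value is finite, so it is the image of a real rate.
  have hcoe := EReal.coe_toReal (iidRateDistortion_lt_top (candidateDist P) hD.le).ne
    ((EReal.bot_lt_zero.trans_le (iidRateDistortion_nonneg hp (candidateDistortion m d) D)).ne')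
  constructor
  · refine ⟨_, ?_, hcoe⟩
    have hex : ∀ n : ℕ, ∃ B : Finset (Fin n → Y), 1 ≤ n → HelpfulFeasible P d D B ∧
        helpfulRate P d D n = ((Real.log B.card / n : ℝ) : EReal) := by
      intro n
      by_cases hn : 1 ≤ n
      · obtain ⟨B, hB⟩ := exists_helpfulRate_eq (P := P) (d := d) (D := D) (n := n)
          ⟨Finset.univ, (helpfulFeasible_iff hm hP.1 d D _).2
            ⟨_, (sourceDistortion_univ_le hp _ hn).trans hD.le⟩⟩
        exact ⟨B, fun _ => hB⟩
      · exact ⟨∅, fun h => absurd h hn⟩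
    choose B hB using hex
    refine ⟨B, fun n hn => (hB n hn).1, ?_⟩
    rw [← EReal.tendsto_coe, hcoe]
    refine (tendsto_helpfulRate hm hP hd hD.ne').congr' ?_
    filter_upwards [eventually_ge_atTop 1] with n hn
    exact (hB n hn).2
  · rintro _ ⟨R, ⟨B, hB, hR⟩, rfl⟩
    refine ge_of_tendsto (EReal.tendsto_coe.2 hR) ?_
    filter_upwards [eventually_ge_atTop 1] with n hn
    exact (iidRateDistortion_le_helpfulRate hm hP d D hn).trans (helpfulRate_le (hB n hn))

end HelpfulRate

end SwitcherAVS

theorem theorem3 {X Y : Type*} [Fintype X] [DecidableEq X] [Fintype Y] [Nonempty Y]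
    (m : ℕ) (hm : 1 ≤ m) (d : X → Y → ℝ) (hd : ∀ x y, 0 ≤ d x y)
    (P : (Fin m → X) → ℝ) (hP : P ∈ stdSimplex ℝ (Fin m → X)) :
    -- the candidate sets are IID with distribution `β`
    candidateDist P ∈ stdSimplex ℝ (CandidateSet X m) ∧
    (∀ (n : ℕ) (V : Fin n → CandidateSet X m),
      (∑ z : Fin n → Fin m → X with ∀ k, Finset.univ.image (z k) = (V k).1, blockProb P z) =
        ∏ k, candidateDist P (V k)) ∧
    -- `R(D) = R*(β, D)`, and the upper limit defining `R(D)` is a limit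
    (∀ D : ℝ, D ≠ minDistortion (candidateDist P) (candidateDistortion m d) →
      helpfulRateDistortion P d D =
        iidRateDistortion (candidateDist P) (candidateDistortion m d) D ∧
      Tendsto (helpfulRate P d D) atTop
        (𝓝 (iidRateDistortion (candidateDist P) (candidateDistortion m d) D))) ∧
    -- at the minimal distortion `R` is read as its limit from the right
    Tendsto (helpfulRateDistortion P d)
      (𝓝[>] (minDistortion (candidateDist P) (candidateDistortion m d)))
      (𝓝 (iidRateDistortion (candidateDist P) (candidateDistortion m d)
        (minDistortion (candidateDist P) (candidateDistortion m d)))) ∧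
    -- `R*(β, D)` is the smallest achievable rate
    (∀ D : ℝ, minDistortion (candidateDist P) (candidateDistortion m d) < D →
      IsLeast (Real.toEReal '' {R : ℝ | HelpfulAchievable P d D R})
        (iidRateDistortion (candidateDist P) (candidateDistortion m d) D)) := by
  have hlimsup : ∀ D : ℝ, D ≠ minDistortion (candidateDist P) (candidateDistortion m d) →
      helpfulRateDistortion P d D =
        iidRateDistortion (candidateDist P) (candidateDistortion m d) D := fun D hD =>
    (tendsto_helpfulRate hm hP hd hD).limsup_eq
  have hp := candidateDist_mem_stdSimplex hm hP
  refine ⟨hp, fun n V => sum_blockProb_eq_prod_candidateDist P V,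
    fun D hD => ⟨hlimsup D hD, tendsto_helpfulRate hm hP hd hD⟩, ?_,
    fun D hD => isLeast_helpfulAchievable hm hP hd hD⟩
  -- Strictly to the right of the minimal distortion the two functions agree, so right continuity
  -- transfers the limit.
  refine (iidRateDistortion_tendsto_nhdsGT hp _ _).congr' ?_
  filter_upwards [self_mem_nhdsWithin] with D hD
  exact (hlimsup D (ne_of_gt hD)).symm
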